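/- For an integer $n$ put $G_n(z) = -1 + z + z^n$, and for $n \ge 4$ let $z_{1,n}$ denote the first root of $G_n$, that is, the root of smallest argument among the roots of $G_n$ in the open upper half-plane $\{\mathrm{Im}\, z > 0\}$ (it exists and is unique). Let $a_{\max} = 5.8743\ldots$ be the unique point of $[1,+\infty)$ at which the function $$h(1,a) := \frac{\left|1-e^{\pi/a}\right| e^{-\pi/a}}{e^{\pi/a} + \left|1-e^{\pi/a}\right|}$$ attains its maximum over $[1,+\infty)$. Theorem. Let $n \ge 32$ and let $$C_{1,n} := \left\{ z \in \mathbb{C} \;:\; |z - z_{1,n}| = \frac{\pi |z_{1,n}|}{n\, a_{\max}} \right\}.$$ Then every $z \in C_{1,n}$ satisfies $|z| < 1$ and $$\frac{|z|^{2n-1}}{1-|z|^{n-1}} < \left| -1 + z + z^n \right|.$$ -/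

import Mathlib

/-- The trinomial `G_n(z) = -1 + z + z^n` as a function on the complex plane. -/
def trinomialG (n : ℕ) (z : ℂ) : ℂ := -1 + z + z ^ n

/-- `z` is the first root of `G_n`: among the roots of `G_n` in the open upper half plane it is
one of smallest argument. -/
def IsFirstRoot (n : ℕ) (z : ℂ) : Prop :=
  trinomialG n z = 0 ∧ 0 < z.im ∧
    ∀ w : ℂ, trinomialG n w = 0 → 0 < w.im → z.arg ≤ w.arg

/-- The first root `z_{1,n}` of `G_n` (see `existsUnique_isFirstRoot`). -/
noncomputable def firstRoot (n : ℕ) : ℂ := Classical.epsilon (IsFirstRoot n)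

/-- The function `a ↦ h(1,a)`. -/
noncomputable def roucheH (a : ℝ) : ℝ :=
  |1 - Real.exp (Real.pi / a)| * Real.exp (-Real.pi / a) /
    (Real.exp (Real.pi / a) + |1 - Real.exp (Real.pi / a)|)

/-- `a` is a point of `[1, ∞)` at which `h(1, ·)` attains its maximum over `[1, ∞)`. -/
def IsRoucheMax (a : ℝ) : Prop := a ∈ Set.Ici (1 : ℝ) ∧ IsMaxOn roucheH (Set.Ici 1) a

/-- The point `a_max` at which `h(1, ·)` attains its maximum over `[1, ∞)`
(see `existsUnique_isRoucheMax`). -/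
noncomputable def aMax : ℝ := Classical.epsilon IsRoucheMax

/-! ### The two objects above are well defined -/

theorem isFirstRoot_unique {n : ℕ} (hn : 4 ≤ n) {z w : ℂ}
    (hz : IsFirstRoot n z) (hw : IsFirstRoot n w) : z = w := by
  obtain ⟨hz0, hzi, hzm⟩ := hz
  obtain ⟨hw0, hwi, hwm⟩ := hw
  have hz1 : z ≠ 0 := by rintro rfl; simp at hzi
  have hw1 : w ≠ 0 := by rintro rfl; simp at hwi
  have harg : z.arg = w.arg := le_antisymm (hzm w hw0 hwi) (hwm z hz0 hzi)
  have h := (Complex.arg_eq_arg_iff hz1 hw1).1 harg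
  set t : ℝ := ‖w‖ / ‖z‖ with ht
  have ht0 : 0 < t := by positivity
  have h' : w = (t : ℂ) * z := by rw [← h, ht]; push_cast; ring
  unfold trinomialG at hz0 hw0
  have hzn : z ^ n = 1 - z := by linear_combination hz0
  rw [h', mul_pow, hzn] at hw0
  have him := congrArg Complex.im hw0
  rw [← Complex.ofReal_pow] at him
  simp only [Complex.add_im, Complex.neg_im, Complex.one_im, Complex.im_ofReal_mul,
    Complex.sub_im, Complex.zero_im] at him
  have h2 : (t - t ^ n) * z.im = 0 := by linear_combination him
  have h3 : t = t ^ n := by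
    rcases mul_eq_zero.1 h2 with h | h
    · linarith
    · exact absurd h hzi.ne'
  have h4 : t ^ (n - 1) = 1 := by
    have : t * t ^ (n - 1) = t * 1 := by
      rw [← pow_succ', Nat.sub_add_cancel (by omega), ← h3, mul_one]
    exact mul_left_cancel₀ ht0.ne' this
  have h5 : t = 1 := (pow_eq_one_iff_of_nonneg ht0.le (by omega)).1 h4
  rw [h', h5]; simp

theorem not_three_real_roots {n : ℕ} (hn : 4 ≤ n) {x y z : ℝ} (hxy : x < y) (hyz : y < z)
    (hx : -1 + x + x ^ n = 0) (hy : -1 + y + y ^ n = 0) (hz : -1 + z + z ^ n = 0) : False := by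
  rcases Nat.even_or_odd n with he | ho
  · have hc := he.strictConvexOn_pow (by omega : n ≠ 0)
    have := hc.slope_strict_mono_adjacent (Set.mem_univ x) (Set.mem_univ z) hxy hyz
    rw [show y ^ n - x ^ n = -(y - x) by linarith, show z ^ n - y ^ n = -(z - y) by linarith,
      neg_div, neg_div, div_self (by linarith), div_self (by linarith)] at this
    exact lt_irrefl _ this
  · have := ho.strictMono_pow hxy
    simp only at this
    linarith

open Polynomial in
theorem exists_trinomialG_root_im_pos {n : ℕ} (hn : 4 ≤ n) :
    ∃ z : ℂ, trinomialG n z = 0 ∧ 0 < z.im := by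
  by_contra! hcon
  have hreal : ∀ z : ℂ, trinomialG n z = 0 → z.im = 0 := by
    intro z hz
    refine le_antisymm (hcon z hz) ?_
    have h := hcon (starRingEnd ℂ z) (by
      have := congrArg (starRingEnd ℂ) hz
      simpa [trinomialG] using this)
    simpa using h
  set p : ℂ[X] := X ^ n + (X - C 1) with hp
  have hdeg1 : (X - C 1 : ℂ[X]).degree < n := by
    rw [degree_X_sub_C]; exact_mod_cast (by omega : 1 < n)
  have hdeg : p.natDegree = n := by
    rw [hp]
    refine natDegree_eq_of_degree_eq_some ?_
    rw [degree_add_eq_left_of_degree_lt (by rwa [degree_X_pow]), degree_X_pow]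
  have hp0 : p ≠ 0 := by
    intro h; rw [h] at hdeg; simp at hdeg; omega
  have heval : ∀ z, p.IsRoot z ↔ trinomialG n z = 0 := by
    intro z
    simp only [hp, IsRoot.def, eval_add, eval_pow, eval_X, eval_sub, eval_C, trinomialG]
    constructor <;> intro h <;> linear_combination h
  have hnodup : p.roots.Nodup := by
    rw [Multiset.nodup_iff_count_le_one]
    intro z
    by_contra! hlt
    rw [count_roots, one_lt_rootMultiplicity_iff_isRoot hp0] at hlt
    obtain ⟨hr, hd⟩ := hlt
    have hr' := (heval z).1 hr
    have him := hreal z hr'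
    obtain ⟨x, rfl⟩ : ∃ x : ℝ, z = x := ⟨z.re, by apply Complex.ext <;> simp [him]⟩
    simp only [hp, IsRoot.def, derivative_add, derivative_X_pow, derivative_sub, derivative_X,
      derivative_C, eval_add, eval_mul, eval_pow, eval_X, eval_sub, eval_one, eval_zero,
      eval_C] at hd
    have hd' : (n : ℝ) * x ^ (n - 1) + 1 = 0 := by
      have : (((n : ℝ) * x ^ (n - 1) + 1 : ℝ) : ℂ) = 0 := by
        push_cast; linear_combination hd
      exact_mod_cast this
    have hr2 : -1 + x + x ^ n = 0 := by
      have : ((-1 + x + x ^ n : ℝ) : ℂ) = 0 := by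
        push_cast; unfold trinomialG at hr'; exact hr'
      exact_mod_cast this
    have hxn : x ^ n = x * x ^ (n - 1) := by
      rw [← pow_succ', Nat.sub_add_cancel (by omega)]
    rw [hxn] at hr2
    have h3 : ((n : ℝ) - 1) * x = n := by linear_combination n * hr2 - x * hd'
    have hn' : (4 : ℝ) ≤ n := by exact_mod_cast hn
    have hx : 0 < x := by
      by_contra! hx
      nlinarith
    have : 0 < x ^ (n - 1) := by positivity
    nlinarith
  have hcard : p.roots.toFinset.card = n := by
    rw [Multiset.toFinset_card_of_nodup hnodup, ← hdeg]
    exact (splits_iff_card_roots.1 (IsAlgClosed.splits p))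
  set s : Finset ℝ := p.roots.toFinset.image Complex.re with hs
  have hmem : ∀ x ∈ s, -1 + x + x ^ n = 0 := by
    intro x hx
    rw [hs, Finset.mem_image] at hx
    obtain ⟨z, hz, rfl⟩ := hx
    rw [Multiset.mem_toFinset, mem_roots hp0, heval] at hz
    have hzr : z = (z.re : ℂ) := by apply Complex.ext <;> simp [hreal z hz]
    have : ((-1 + z.re + z.re ^ n : ℝ) : ℂ) = 0 := by
      push_cast; rw [← hzr]; exact hz
    exact_mod_cast this
  have hscard : s.card = n := by
    rw [hs, Finset.card_image_of_injOn, hcard]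
    intro z hz w hw hzw
    simp only [Finset.mem_coe, Multiset.mem_toFinset, mem_roots hp0, heval] at hz hw
    exact Complex.ext hzw (by rw [hreal z hz, hreal w hw])
  let e := s.orderEmbOfFin hscard
  exact not_three_real_roots hn (x := e ⟨0, by omega⟩) (y := e ⟨1, by omega⟩)
    (z := e ⟨2, by omega⟩) (e.strictMono (by simp)) (e.strictMono (by simp))
    (hmem _ (s.orderEmbOfFin_mem hscard _)) (hmem _ (s.orderEmbOfFin_mem hscard _))
    (hmem _ (s.orderEmbOfFin_mem hscard _))

open Polynomial in
theorem finite_trinomialG_roots {n : ℕ} (hn : 4 ≤ n) :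
    {z : ℂ | trinomialG n z = 0 ∧ 0 < z.im}.Finite := by
  have hdeg1 : (X - C 1 : ℂ[X]).degree < n := by
    rw [degree_X_sub_C]; exact_mod_cast (by omega : 1 < n)
  have hp0 : (X ^ n + (X - C 1) : ℂ[X]) ≠ 0 := by
    intro h
    have := degree_add_eq_left_of_degree_lt (p := (X ^ n : ℂ[X])) (q := X - C 1) (by rwa [degree_X_pow])
    rw [h, degree_X_pow] at this; simp at this
  refine (finite_setOfPred_isRoot hp0).subset ?_
  rintro z ⟨hz, -⟩
  simp only [Set.mem_ofPred_eq, IsRoot.def, eval_add, eval_pow, eval_X, eval_sub, eval_C]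
  unfold trinomialG at hz
  linear_combination hz

theorem existsUnique_isFirstRoot {n : ℕ} (hn : 4 ≤ n) : ∃! z : ℂ, IsFirstRoot n z := by
  obtain ⟨z, ⟨hz0, hzi⟩, hz⟩ := Set.exists_min_image _ Complex.arg (finite_trinomialG_roots hn)
    (exists_trinomialG_root_im_pos hn)
  have h : IsFirstRoot n z := ⟨hz0, hzi, fun w h1 h2 => hz w ⟨h1, h2⟩⟩
  exact ⟨z, h, fun w hw => isFirstRoot_unique hn hw h⟩

theorem firstRoot_spec {n : ℕ} (hn : 4 ≤ n) : IsFirstRoot n (firstRoot n) :=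
  Classical.epsilon_spec (existsUnique_isFirstRoot hn).exists

theorem roucheH_eq {a : ℝ} (ha : 1 ≤ a) : roucheH a =
    (3 - 2 * √2) - ((2 - √2) * Real.exp (Real.pi / a) - 1) ^ 2 /
      (Real.exp (Real.pi / a) * (2 * Real.exp (Real.pi / a) - 1)) := by
  have hx : 1 < Real.exp (Real.pi / a) := Real.one_lt_exp_iff.2 (by positivity)
  unfold roucheH
  rw [neg_div, Real.exp_neg]
  set x := Real.exp (Real.pi / a)
  rw [abs_of_neg (by linarith)]
  have h2 : √2 ^ 2 = 2 := Real.sq_sqrt (by norm_num)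
  have hx0 : x ≠ 0 := by positivity
  have hx1 : 2 * x - 1 ≠ 0 := by linarith
  have hx2 : x + -(1 - x) ≠ 0 := by linarith
  rw [show x + -(1 - x) = 2 * x - 1 by ring]
  rw [← div_eq_mul_inv, div_div, eq_sub_iff_add_eq, ← add_div,
    div_eq_iff (mul_ne_zero hx0 hx1)]
  linear_combination (x ^ 2) * h2

theorem existsUnique_isRoucheMax : ∃! a : ℝ, IsRoucheMax a := by
  have h2 : √2 ^ 2 = 2 := Real.sq_sqrt (by norm_num)
  have hs1 : 1 < √2 := by rw [Real.lt_sqrt] <;> norm_num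
  have hs2 : √2 < 2 := by rw [Real.sqrt_lt'] <;> norm_num
  set x₀ : ℝ := 1 + √2 / 2 with hx₀
  have hx₀e : (2 - √2) * x₀ - 1 = 0 := by rw [hx₀]; linear_combination (-1 / 2) * h2
  have hlog0 : 0 < Real.log x₀ := Real.log_pos (by rw [hx₀]; linarith)
  have hlog1 : Real.log x₀ ≤ x₀ - 1 := Real.log_le_sub_one_of_pos (by rw [hx₀]; linarith)
  have hpi := Real.pi_gt_three
  have hle : ∀ a : ℝ, 1 ≤ a → roucheH a ≤ 3 - 2 * √2 := by
    intro a ha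
    rw [roucheH_eq ha]
    have hx : 1 < Real.exp (Real.pi / a) := Real.one_lt_exp_iff.2 (by positivity)
    have : 0 < 2 * Real.exp (Real.pi / a) - 1 := by linarith
    have : 0 ≤ ((2 - √2) * Real.exp (Real.pi / a) - 1) ^ 2 /
      (Real.exp (Real.pi / a) * (2 * Real.exp (Real.pi / a) - 1)) := by positivity
    linarith
  have ha1 : 1 ≤ Real.pi / Real.log x₀ := by
    rw [le_div_iff₀ hlog0]; rw [hx₀] at hlog1 ⊢; linarith
  have hval : roucheH (Real.pi / Real.log x₀) = 3 - 2 * √2 := by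
    rw [roucheH_eq ha1, div_div_cancel₀ Real.pi_ne_zero,
      Real.exp_log (by rw [hx₀]; linarith), hx₀e]
    simp
  refine ⟨Real.pi / Real.log x₀, ⟨ha1, ?_⟩, ?_⟩
  · intro b hb
    simp only [Set.mem_ofPred_eq]
    rw [hval]; exact hle b hb
  · rintro b ⟨hb, hmax⟩
    have hb1 : 1 ≤ b := hb
    have h := hmax (Set.mem_Ici.2 ha1)
    simp only [Set.mem_ofPred_eq] at h
    rw [hval, roucheH_eq hb1] at h
    have hx : 1 < Real.exp (Real.pi / b) := Real.one_lt_exp_iff.2 (by positivity)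
    have hD : 0 < Real.exp (Real.pi / b) * (2 * Real.exp (Real.pi / b) - 1) :=
      mul_pos (by linarith) (by linarith)
    have h3 : ((2 - √2) * Real.exp (Real.pi / b) - 1) ^ 2 ≤ 0 := by
      by_contra! hc
      have := div_pos hc hD
      linarith
    have h4 : (2 - √2) * Real.exp (Real.pi / b) - 1 = 0 := by
      exact pow_eq_zero_iff (two_ne_zero) |>.1 (le_antisymm h3 (sq_nonneg _))
    have h5 : Real.exp (Real.pi / b) = x₀ :=
      mul_left_cancel₀ (by linarith : (2 - √2) ≠ 0) (by linarith)
    rw [← h5, Real.log_exp, div_div_cancel₀ Real.pi_ne_zero]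

theorem aMax_spec : IsRoucheMax aMax :=
  Classical.epsilon_spec existsUnique_isRoucheMax.exists

/-! Write `L = π / aMax`, `ρ = L / n`, `r = |z₁|`, `d = r ^ n = |1 - z₁|`, and `z = z₁ (1 + ρ w)`
with `|w| = 1`. Since `z₁ ^ n = 1 - z₁`, `G_n(z) = (1 - z₁) ((1 + ρ w) ^ n - 1 + ρ w z₁ / (1 -
z₁))`. Multiplying the bracket by `conj w` and taking real parts bounds its modulus below by an
affine function of `Re w`. With `q = |1 + ρ w|`, the left side, divided by `d`, is `d q (q ^ (n-1))
^ 2 / (r - d q ^ (n-1))`. Here `q ^ 2` is affine in `Re w`, so convexity bounds `(q ^ (n-1)) ^ 2` by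
a chord, and the remaining `q` factors are replaced by their maxima. The comparison is then affine
in `Re w`, so it suffices to check `w = 1` and `w = -1`. The case `w = 1` is tight. It uses `e ^ L =
1 + √2 / 2`, `r ≥ 0.94` and `d ≤ 0.166`, sharpened to `d ≤ 0.158` for `n ≥ 34`. For `n = 32, 33` the
positive term `ρ Re (z₁ / (1 - z₁))` makes up the difference. The bounds on `r` and `d` come from
the polar equations of the root, once its argument is known to be at most `2π / n`. -/

/-! ### Estimates on the circle that are affine in `Re w` -/

/-- On the unit circle `|v - 1| ^ 2 = 2 (1 - Re v)`, so this is the square of `|w ^ j - 1| ≤ j |w -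
1|`. -/
theorem one_sub_re_pow_le {w : ℂ} (hw : ‖w‖ = 1) (j : ℕ) :
    1 - (w ^ j).re ≤ (j : ℝ) ^ 2 * (1 - w.re) := by
  have key : ∀ v : ℂ, ‖v‖ = 1 → ‖v - 1‖ ^ 2 = 2 * (1 - v.re) := by
    intro v hv
    have h1 : v.re ^ 2 + v.im ^ 2 = 1 := by
      have := Complex.sq_norm v
      rw [hv, Complex.normSq_apply] at this
      linarith
    rw [Complex.sq_norm, Complex.normSq_apply]
    simp
    linarith
  have hle : ‖w ^ j - 1‖ ≤ j * ‖w - 1‖ := by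
    induction j with
    | zero => simp
    | succ k ih =>
      calc ‖w ^ (k + 1) - 1‖ = ‖w * (w ^ k - 1) + (w - 1)‖ := by ring_nf
        _ ≤ ‖w * (w ^ k - 1)‖ + ‖w - 1‖ := norm_add_le _ _
        _ ≤ k * ‖w - 1‖ + ‖w - 1‖ := by rw [norm_mul, hw, one_mul]; gcongr
        _ = _ := by push_cast; ring
  have h2 := pow_le_pow_left₀ (norm_nonneg _) hle 2
  rw [mul_pow, key w hw, key _ (by rw [norm_pow, hw, one_pow])] at h2
  linarith

theorem one_add_pow_sub_one_eq {R : Type*} [CommRing R] (n : ℕ) (x : R) :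
    (1 + x) ^ n - 1 = ∑ j ∈ Finset.range n, (n.choose (j + 1) : R) * x ^ (j + 1) := by
  rw [add_comm, add_pow, Finset.sum_range_succ']
  simp [mul_comm]

theorem choose_mul_div_pow_le {n : ℕ} (hn : 0 < n) {L : ℝ} (hL : 0 ≤ L) (j : ℕ) :
    (n.choose j : ℝ) * (L / n) ^ j ≤ L ^ j / j.factorial := by
  have h := Nat.choose_le_pow_div (α := ℝ) j n
  have hn' : (0 : ℝ) < n := by exact_mod_cast hn
  calc (n.choose j : ℝ) * (L / n) ^ j ≤ (n : ℝ) ^ j / j.factorial * (L / n) ^ j := by gcongr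
    _ = _ := by rw [div_pow]; field_simp

theorem sum_sq_mul_pow_div_factorial_le {L : ℝ} (hL0 : 0 ≤ L) (hL : L ≤ 0.535) (n : ℕ) :
    ∑ j ∈ Finset.range n, (j : ℝ) ^ 2 * (L ^ (j + 1) / (j + 1).factorial) ≤ 0.2877 := by
  set g : ℕ → ℝ := fun j => (j : ℝ) ^ 2 * (L ^ (j + 1) / (j + 1).factorial) with hg
  have hg0 : ∀ j, 0 ≤ g j := fun j => by positivity
  -- From `j = 4` on the terms at least halve, so the tail is at most `2 * g 4`.
  have hstep : ∀ j, 4 ≤ j → 2 * g (j + 1) ≤ g j := by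
    intro j hj
    have hj' : (4 : ℝ) ≤ j := by exact_mod_cast hj
    have hfac : ((j + 1 + 1).factorial : ℝ) = (j + 2) * (j + 1).factorial := by
      rw [Nat.factorial_succ (j + 1)]; push_cast; ring
    have hf : (0 : ℝ) < (j + 1).factorial := by positivity
    simp only [hg, hfac]
    have e : 2 * (((j + 1 : ℕ) : ℝ) ^ 2 * (L ^ (j + 1 + 1) / ((j + 2) * (j + 1).factorial))) =
      (2 * ((j : ℝ) + 1) ^ 2 * L / (j + 2)) * (L ^ (j + 1) / (j + 1).factorial) := by
      rw [pow_succ L (j + 1)]; push_cast; field_simp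
    rw [e]
    refine mul_le_mul_of_nonneg_right ?_ (by positivity)
    rw [div_le_iff₀ (by linarith)]
    nlinarith [mul_le_mul_of_nonneg_left hL (by positivity : 0 ≤ 2 * ((j : ℝ) + 1) ^ 2)]
  have hind : ∀ k, ∑ j ∈ Finset.range (k + 4), g j + 2 * g (k + 4) ≤
      ∑ j ∈ Finset.range 4, g j + 2 * g 4 := by
    intro k
    induction k with
    | zero => simp
    | succ k ih =>
      rw [show k + 1 + 4 = (k + 4) + 1 by ring, Finset.sum_range_succ]
      linarith [hstep (k + 4) (by omega)]
  have hbase : ∑ j ∈ Finset.range 4, g j + 2 * g 4 ≤ 0.2877 := by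
    have h2 : L ^ 2 ≤ 0.535 ^ 2 := by gcongr
    have h3 : L ^ 3 ≤ 0.535 ^ 3 := by gcongr
    have h4 : L ^ 4 ≤ 0.535 ^ 4 := by gcongr
    have h5 : L ^ 5 ≤ 0.535 ^ 5 := by gcongr
    simp only [hg, Finset.sum_range_succ, Finset.sum_range_zero, Nat.factorial]
    norm_num at h2 h3 h4 h5 ⊢
    linarith
  calc ∑ j ∈ Finset.range n, g j ≤ ∑ j ∈ Finset.range (n + 4), g j :=
        Finset.sum_le_sum_of_subset_of_nonneg (by simp) fun j _ _ => hg0 j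
    _ ≤ 0.2877 := by linarith [hind n, hg0 (n + 4)]

/-- The factor `conj w` lowers each power in the binomial expansion by one, leaving positive
coefficients times `w ^ j`. The loss against `w = 1` is then at most a sum of `j ^ 2 L ^ (j+1) /
(j+1)!` times `1 - Re w`. -/
theorem re_conj_mul_one_add_pow_sub_one_ge {n : ℕ} (hn : 0 < n) {L : ℝ} (hL0 : 0 ≤ L)
    (hL : L ≤ 0.535) {w : ℂ} (hw : ‖w‖ = 1) :
    (1 + L / n) ^ n - 1 - 0.2877 * (1 - w.re) ≤
      (starRingEnd ℂ w * ((1 + (L / n : ℝ) * w) ^ n - 1)).re := by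
  have hconj : starRingEnd ℂ w * w = 1 := by
    rw [mul_comm, Complex.mul_conj, Complex.normSq_eq_norm_sq, hw]; simp
  have e : starRingEnd ℂ w * ((1 + (L / n : ℝ) * w) ^ n - 1) =
      ∑ j ∈ Finset.range n, ((n.choose (j + 1) * (L / n) ^ (j + 1) : ℝ) : ℂ) * w ^ j := by
    rw [one_add_pow_sub_one_eq, Finset.mul_sum]
    refine Finset.sum_congr rfl fun j _ => ?_
    rw [mul_pow, pow_succ w]
    push_cast
    linear_combination (n.choose (j + 1) * ((L : ℂ) / n) ^ (j + 1) * w ^ j) * hconj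
  have hre : w.re ≤ 1 := hw ▸ Complex.re_le_norm w
  rw [e, Complex.re_sum, one_add_pow_sub_one_eq]
  simp only [Complex.re_ofReal_mul]
  have hterm : ∀ j ∈ Finset.range n, (n.choose (j + 1) * (L / n) ^ (j + 1) : ℝ) * (1 - (w ^ j).re) ≤
      (j : ℝ) ^ 2 * (L ^ (j + 1) / (j + 1).factorial) * (1 - w.re) := by
    intro j _
    have h1 := one_sub_re_pow_le hw j
    have h2 := choose_mul_div_pow_le hn hL0 (j + 1)
    have h3 : 0 ≤ (n.choose (j + 1) * (L / n) ^ (j + 1) : ℝ) := by positivity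
    calc _ ≤ (n.choose (j + 1) * (L / n) ^ (j + 1) : ℝ) * ((j : ℝ) ^ 2 * (1 - w.re)) := by gcongr
      _ ≤ L ^ (j + 1) / (j + 1).factorial * ((j : ℝ) ^ 2 * (1 - w.re)) := by
        have : 0 ≤ 1 - w.re := by linarith
        gcongr
      _ = _ := by ring
  have hs := Finset.sum_le_sum hterm
  rw [← Finset.sum_mul] at hs
  have hb := mul_le_mul_of_nonneg_right (sum_sq_mul_pow_div_factorial_le hL0 hL n)
    (by linarith : 0 ≤ 1 - w.re)
  simp only [mul_sub, mul_one, Finset.sum_sub_distrib] at hs hb ⊢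
  linarith

/-- `|1 + ρ w| ^ 2` is the convex combination of `(1 + ρ) ^ 2` and `(1 - ρ) ^ 2` with weights `(1 ±
Re w) / 2`, and `x ^ k` is convex on `[0, ∞)`. -/
theorem norm_one_add_mul_sq_pow_le (ρ : ℝ) {w : ℂ} (hw : ‖w‖ = 1)
    (k : ℕ) :
    (‖1 + (ρ : ℂ) * w‖ ^ k) ^ 2 ≤ (1 + w.re) / 2 * ((1 + ρ) ^ k) ^ 2 +
      (1 - w.re) / 2 * ((1 - ρ) ^ k) ^ 2 := by
  have h1 : w.re ^ 2 + w.im ^ 2 = 1 := by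
    have := Complex.sq_norm w
    rw [hw, Complex.normSq_apply] at this
    linarith
  have e : ‖1 + (ρ : ℂ) * w‖ ^ 2 = (1 + w.re) / 2 * (1 + ρ) ^ 2 + (1 - w.re) / 2 * (1 - ρ) ^ 2 := by
    rw [Complex.sq_norm, Complex.normSq_apply]
    simp
    linear_combination ρ ^ 2 * h1
  have hre := abs_le.1 (hw ▸ Complex.abs_re_le_norm w)
  rw [← pow_mul, mul_comm k, pow_mul, e]
  have hc : ConvexOn ℝ (Set.Ici 0) fun x : ℝ => x ^ k := convexOn_pow k
  have := hc.2 (Set.mem_Ici.2 (sq_nonneg (1 + ρ))) (Set.mem_Ici.2 (sq_nonneg (1 - ρ)))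
    (by linarith : 0 ≤ (1 + w.re) / 2) (by linarith : 0 ≤ (1 - w.re) / 2) (by ring)
  simp only [smul_eq_mul] at this
  rw [← pow_mul, ← pow_mul, mul_comm k 2, pow_mul, pow_mul]
  exact this

/-! ### Numerical values attached to `aMax`, and exponential bounds -/

/-- By `roucheH_eq`, `h(1, a)` is `3 - 2√2` minus a square over a positive quantity, so a maximum
makes the square vanish. -/
theorem exp_pi_div_of_isRoucheMax {a : ℝ} (h : IsRoucheMax a) :
    Real.exp (Real.pi / a) = 1 + √2 / 2 := by
  have h2 : √2 ^ 2 = 2 := Real.sq_sqrt (by norm_num)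
  have hs1 : 1 < √2 := by rw [Real.lt_sqrt] <;> norm_num
  have hs2 : √2 < 2 := by rw [Real.sqrt_lt'] <;> norm_num
  have hx₀e : (2 - √2) * (1 + √2 / 2) - 1 = 0 := by linear_combination (-1 / 2) * h2
  have hlog0 : 0 < Real.log (1 + √2 / 2) := Real.log_pos (by linarith)
  have hlog1 : Real.log (1 + √2 / 2) ≤ (1 + √2 / 2) - 1 := Real.log_le_sub_one_of_pos (by linarith)
  have ha1 : 1 ≤ Real.pi / Real.log (1 + √2 / 2) := by
    rw [le_div_iff₀ hlog0]; linarith [Real.pi_gt_three]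
  have hval : roucheH (Real.pi / Real.log (1 + √2 / 2)) = 3 - 2 * √2 := by
    rw [roucheH_eq ha1, div_div_cancel₀ Real.pi_ne_zero, Real.exp_log (by linarith), hx₀e]
    simp
  obtain ⟨hb1, hmax⟩ := h
  have hb1 : 1 ≤ a := hb1
  have h := hmax (Set.mem_Ici.2 ha1)
  simp only [Set.mem_ofPred_eq] at h
  rw [hval, roucheH_eq hb1] at h
  have hx : 1 < Real.exp (Real.pi / a) := Real.one_lt_exp_iff.2 (by positivity)
  have hD : 0 < Real.exp (Real.pi / a) * (2 * Real.exp (Real.pi / a) - 1) :=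
    mul_pos (by linarith) (by linarith)
  have h3 : ((2 - √2) * Real.exp (Real.pi / a) - 1) ^ 2 ≤ 0 := by
    by_contra! hc
    have := div_pos hc hD
    linarith
  have h4 : (2 - √2) * Real.exp (Real.pi / a) - 1 = 0 :=
    pow_eq_zero_iff (two_ne_zero) |>.1 (le_antisymm h3 (sq_nonneg _))
  exact mul_left_cancel₀ (by linarith : (2 - √2) ≠ 0) (by linarith)

theorem exp_pi_div_aMax_bounds :
    1.7071 < Real.exp (Real.pi / aMax) ∧ Real.exp (Real.pi / aMax) < 1.7072 := by
  rw [exp_pi_div_of_isRoucheMax aMax_spec]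
  have h1 : 1.4142 < √2 := by rw [Real.lt_sqrt] <;> norm_num
  have h2 : √2 < 1.4143 := by rw [Real.sqrt_lt'] <;> norm_num
  constructor <;> linarith

theorem pi_div_aMax_bounds : 0.534 < Real.pi / aMax ∧ Real.pi / aMax < 0.535 := by
  obtain ⟨h1, h2⟩ := exp_pi_div_aMax_bounds
  constructor
  · rw [← Real.exp_lt_exp]
    refine lt_of_le_of_lt ?_ h1
    have := Real.exp_bound' (x := 0.534) (by norm_num) (by norm_num) (n := 6) (by norm_num)
    refine this.trans ?_
    norm_num [Finset.sum_range_succ, Nat.factorial]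
  · rw [← Real.exp_lt_exp]
    refine h2.trans_le ?_
    refine le_trans ?_ (Real.sum_le_exp_of_nonneg (x := 0.535) (by norm_num) 6)
    norm_num [Finset.sum_range_succ, Nat.factorial]

theorem one_add_div_pow_le_exp {n : ℕ} (hn : 0 < n) {x : ℝ} (hx : -n ≤ x) :
    (1 + x / n) ^ n ≤ Real.exp x := by
  have hn' : (0 : ℝ) < n := by exact_mod_cast hn
  have h := Real.add_one_le_exp (x / n)
  have h0 : 0 ≤ 1 + x / n := by
    have : -1 ≤ x / n := by rw [le_div_iff₀ hn']; linarith
    linarith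
  calc (1 + x / n) ^ n ≤ Real.exp (x / n) ^ n := by gcongr; linarith
    _ = Real.exp x := by rw [← Real.exp_nat_mul]; congr 1; field_simp

theorem exp_mul_one_sub_sq_le {x : ℝ} (h0 : 0 ≤ x) (h1 : x ≤ 1) :
    Real.exp x * (1 - x ^ 2 / 2) ≤ 1 + x := by
  have h := Real.exp_bound' h0 h1 (n := 3) (by norm_num)
  norm_num [Finset.sum_range_succ, Nat.factorial] at h
  have h2 : 0 ≤ 1 - x ^ 2 / 2 := by nlinarith
  refine (mul_le_mul_of_nonneg_right h h2).trans ?_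
  nlinarith [pow_nonneg h0 3, pow_nonneg h0 5, mul_nonneg (pow_nonneg h0 3) (sub_nonneg.2 h1), pow_nonneg h0 4]

/-- The previous bound at `x / n`, raised to the power `n`, with Bernoulli's inequality for the
correction factor. -/
theorem exp_mul_le_one_add_div_pow {n : ℕ} (hn : 0 < n) {x : ℝ} (h0 : 0 ≤ x) (h1 : x ≤ 1) :
    Real.exp x * (1 - x ^ 2 / (2 * n)) ≤ (1 + x / n) ^ n := by
  have hn' : (1 : ℝ) ≤ n := by exact_mod_cast hn
  have hx : x / n ≤ 1 := by rw [div_le_one (by linarith)]; linarith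
  have hx0 : 0 ≤ x / n := by positivity
  have hb := one_add_mul_le_pow (a := -((x / n) ^ 2 / 2)) (by nlinarith) n
  have h := pow_le_pow_left₀ (mul_nonneg (Real.exp_pos _).le (by nlinarith))
    (exp_mul_one_sub_sq_le hx0 hx) n
  rw [mul_pow, ← Real.exp_nat_mul, mul_div_cancel₀ _ (by linarith : (n : ℝ) ≠ 0)] at h
  refine le_trans (mul_le_mul_of_nonneg_left ?_ (Real.exp_pos x).le) h
  refine le_trans (le_of_eq ?_) hb
  field_simp
  ring

/-! ### The first root in polar coordinates -/

theorem trinomialG_eq_zero_iff_polar {n : ℕ} (r θ : ℝ) :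
    trinomialG n (r * Complex.exp (θ * Complex.I)) = 0 ↔
      r ^ n * Real.cos (n * θ) + r * Real.cos θ = 1 ∧
        r ^ n * Real.sin (n * θ) + r * Real.sin θ = 0 := by
  have e : trinomialG n (r * Complex.exp (θ * Complex.I)) =
      ((r ^ n * Real.cos (n * θ) + r * Real.cos θ - 1 : ℝ) : ℂ) +
        ((r ^ n * Real.sin (n * θ) + r * Real.sin θ : ℝ) : ℂ) * Complex.I := by
    unfold trinomialG
    rw [mul_pow, ← Complex.exp_nat_mul, ← mul_assoc, Complex.exp_mul_I, Complex.exp_mul_I]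
    push_cast
    ring
  rw [e, Complex.ext_iff]
  simp only [Complex.zero_re,
    Complex.zero_im, Complex.add_re, Complex.add_im, Complex.ofReal_re, Complex.ofReal_im,
    Complex.re_ofReal_mul, Complex.im_ofReal_mul, Complex.I_re, Complex.I_im]
  simp [sub_eq_zero]

theorem sin_nat_sub_one_mul (n : ℕ) (θ : ℝ) : Real.sin ((n - 1) * θ) =
    Real.sin (n * θ) * Real.cos θ - Real.cos (n * θ) * Real.sin θ := by
  rw [sub_mul, one_mul, Real.sin_sub]

/-- Eliminating the modulus, `R = sin (nθ) / sin ((n-1)θ)`, leaves one equation `F θ = 0`. The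
function `F` changes sign between `3π / (2n-1)` and `2π / n`, an interval on which `sin ((n-1)θ) <
0`. -/
theorem exists_trinomialG_root_arg_le {n : ℕ} (hn : 6 ≤ n) :
    ∃ w : ℂ, trinomialG n w = 0 ∧ 0 < w.im ∧ w.arg ≤ 2 * Real.pi / n := by
  have hn' : (6 : ℝ) ≤ n := by exact_mod_cast hn
  have hpi := Real.pi_pos
  set α : ℝ := 3 * Real.pi / (2 * n - 1) with hα
  set β : ℝ := 2 * Real.pi / n with hβ
  have hαβ : α ≤ β := by
    rw [hα, hβ, div_le_div_iff₀ (by linarith) (by linarith)]; nlinarith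
  have hα0 : 0 < α := by rw [hα]; apply div_pos <;> linarith
  have hβn : n * β = 2 * Real.pi := by rw [hβ]; field_simp
  have hαn : (2 * n - 1) * α = 3 * Real.pi := by
    rw [hα]; field_simp [show (2 * (n : ℝ) - 1) ≠ 0 by linarith]
  have hβ2 : β < Real.pi / 2 := by nlinarith
  have hS : ∀ θ ∈ Set.Icc α β, 0 < -Real.sin ((n - 1) * θ) := by
    rintro θ ⟨h1, h2⟩
    have := Real.sin_pos_of_pos_of_lt_pi (x := (n - 1) * θ - Real.pi) (by nlinarith) (by nlinarith)
    rwa [Real.sin_sub_pi] at this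
  set F : ℝ → ℝ := fun θ => (-Real.sin (n * θ)) ^ n -
    Real.sin θ * (-Real.sin ((n - 1) * θ)) ^ (n - 1) with hF
  have hFc : Continuous F := by fun_prop
  have hFα : 0 ≤ F α := by
    -- The angles `nα` and `(n-1)α` are symmetric about `3π/2`, so their sines agree and the claim
    -- reduces to `sin α ≤ cos (α/2)`.
    have e1 : n * α = 3 * Real.pi / 2 + α / 2 := by linear_combination hαn / 2
    have e2 : (n - 1) * α = 3 * Real.pi / 2 - α / 2 := by linear_combination hαn / 2
    have s1 : Real.sin (3 * Real.pi / 2 + α / 2) = -Real.cos (α / 2) := by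
      rw [show 3 * Real.pi / 2 + α / 2 = (α / 2 + Real.pi / 2) + Real.pi by ring,
        Real.sin_add_pi, Real.sin_add_pi_div_two]
    have s2 : Real.sin (3 * Real.pi / 2 - α / 2) = -Real.cos (α / 2) := by
      rw [show 3 * Real.pi / 2 - α / 2 = (Real.pi / 2 - α / 2) + Real.pi by ring,
        Real.sin_add_pi, Real.sin_pi_div_two_sub]
    have s3 : Real.sin α ≤ Real.cos (α / 2) := by
      rw [← Real.cos_pi_div_two_sub]
      apply Real.cos_le_cos_of_nonneg_of_le_pi
      · linarith
      · linarith
      · have : α ≤ 3 * Real.pi / 11 := by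
          rw [hα, div_le_div_iff₀ (by linarith) (by norm_num)]; nlinarith
        linarith
    have hc : 0 ≤ Real.cos (α / 2) :=
      Real.cos_nonneg_of_neg_pi_div_two_le_of_le (by linarith) (by linarith)
    simp only [hF, e1, e2, s1, s2, neg_neg]
    have : Real.cos (α / 2) ^ n = Real.cos (α / 2) * Real.cos (α / 2) ^ (n - 1) := by
      rw [← pow_succ', Nat.sub_add_cancel (by omega)]
    rw [this, sub_nonneg]
    gcongr
  have hFβ : F β ≤ 0 := by
    have h0 : 0 < Real.sin β := Real.sin_pos_of_pos_of_lt_pi (by linarith) (by linarith)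
    have h1 := hS β ⟨hαβ, le_rfl⟩
    simp only [hF, hβn, Real.sin_two_pi]
    rw [neg_zero, zero_pow (by omega), zero_sub]
    exact neg_nonpos.2 (by positivity)
  obtain ⟨θ, ⟨hθ1, hθ2⟩, hθF⟩ := intermediate_value_Icc' hαβ hFc.continuousOn ⟨hFβ, hFα⟩
  have hS' := hS θ ⟨hθ1, hθ2⟩
  have hsin : 0 < Real.sin θ := Real.sin_pos_of_pos_of_lt_pi (by linarith) (by linarith)
  have hT : 0 ≤ -Real.sin (n * θ) := by
    have := Real.sin_nonneg_of_nonneg_of_le_pi (x := n * θ - Real.pi) (by nlinarith) (by nlinarith)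
    rwa [Real.sin_sub_pi] at this
  have hT0 : -Real.sin (n * θ) ≠ 0 := by
    intro h
    simp only [hF, h] at hθF
    rw [zero_pow (by omega), zero_sub, neg_eq_zero] at hθF
    exact (mul_pos hsin (pow_pos hS' _)).ne' hθF
  set S := -Real.sin ((n - 1) * θ) with hSdef
  set R := -Real.sin (n * θ) / S with hR
  have hR0 : 0 < R := div_pos (lt_of_le_of_ne hT hT0.symm) hS'
  have hRS : R * S = -Real.sin (n * θ) := by rw [hR]; field_simp
  have hRn : R ^ n * S = Real.sin θ := by
    have e : S ^ n = S * S ^ (n - 1) := by rw [← pow_succ', Nat.sub_add_cancel (by omega)]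
    have h1 : (-Real.sin (n * θ)) ^ n = Real.sin θ * S ^ (n - 1) := by
      simp only [hF] at hθF; linarith
    rw [hR, div_pow, h1, e]
    field_simp
  refine ⟨R * Complex.exp (θ * Complex.I), (trinomialG_eq_zero_iff_polar R θ).2 ⟨?_, ?_⟩, ?_, ?_⟩
  · apply mul_right_cancel₀ hS'.ne'
    have := sin_nat_sub_one_mul n θ
    linear_combination Real.cos (n * θ) * hRn + Real.cos θ * hRS - hSdef + this
  · apply mul_right_cancel₀ hS'.ne'
    linear_combination Real.sin (n * θ) * hRn + Real.sin θ * hRS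
  · rw [Complex.im_ofReal_mul, Complex.exp_ofReal_mul_I_im]
    positivity
  · rw [Complex.arg_real_mul _ hR0, Complex.arg_exp_mul_I, (toIocMod_eq_self _).2]
    · exact hθ2
    · constructor <;> linarith

/-- The relations satisfied by the polar coordinates `(r, θ)` of a root of `G_n` in the open upper
half plane whose argument is at most `2π / n`. -/
structure IsPolarRoot (n : ℕ) (r θ : ℝ) : Prop where
  pos : 0 < r
  arg_pos : 0 < θ
  arg_le : n * θ ≤ 2 * Real.pi
  pow_mul_sin : r ^ n * Real.sin ((n - 1) * θ) = -Real.sin θ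
  mul_sin : r * Real.sin ((n - 1) * θ) = Real.sin (n * θ)
  pow_sq : (r ^ n) ^ 2 = 1 + r ^ 2 - 2 * r * Real.cos θ

theorem isPolarRoot_firstRoot {n : ℕ} (hn : 6 ≤ n) :
    IsPolarRoot n ‖firstRoot n‖ (firstRoot n).arg := by
  obtain ⟨h0, him, hmin⟩ := firstRoot_spec (n := n) (by omega)
  obtain ⟨w, hw0, hwi, hwa⟩ := exists_trinomialG_root_arg_le hn
  have hne : firstRoot n ≠ 0 := by intro h; rw [h] at him; simp at him
  have hn' : (0 : ℝ) < n := by exact_mod_cast (by omega : 0 < n)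
  rw [← Complex.norm_mul_exp_arg_mul_I (firstRoot n), trinomialG_eq_zero_iff_polar] at h0
  have hle := (hmin w hw0 hwi).trans hwa
  obtain ⟨e1, e2⟩ := h0
  have hs := sin_nat_sub_one_mul n (firstRoot n).arg
  set r := ‖firstRoot n‖
  set θ := (firstRoot n).arg with hθ
  refine ⟨norm_pos_iff.2 hne, ?_, ?_, ?_, ?_, ?_⟩
  · refine lt_of_le_of_ne (Complex.arg_nonneg_iff.2 him.le) fun h => him.ne' ?_
    exact (Complex.arg_eq_zero_iff.1 (by rw [← hθ, ← h])).2
  · rw [le_div_iff₀ hn'] at hle; linarith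
  · rw [hs]; linear_combination Real.cos θ * e2 - Real.sin θ * e1
  · rw [hs]; linear_combination Real.sin (n * θ) * e1 - Real.cos (n * θ) * e2
  · have h1 := Real.sin_sq_add_cos_sq (n * θ)
    have h2 := Real.sin_sq_add_cos_sq θ
    linear_combination (r ^ n * Real.cos (n * θ) + 1 - r * Real.cos θ) * e1 +
      (r ^ n * Real.sin (n * θ) - r * Real.sin θ) * e2 - (r ^ n) ^ 2 * h1 + r ^ 2 * h2

/-! ### Bounds on the modulus and argument of the first root -/

namespace IsPolarRoot

variable {n : ℕ} {r θ : ℝ}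

theorem arg_lt (h : IsPolarRoot n r θ) (hn : 32 ≤ n) : θ < 0.2 := by
  have hn' : (32 : ℝ) ≤ n := by exact_mod_cast hn
  have := h.arg_le
  have := Real.pi_lt_d2
  nlinarith [h.arg_pos]

theorem lt_one (h : IsPolarRoot n r θ) (hn : 32 ≤ n) : r < 1 := by
  by_contra! hr
  have h1 : r ≤ r ^ n := le_self_pow₀ hr (by omega)
  have h2 := pow_le_pow_left₀ h.pos.le h1 2
  rw [h.pow_sq] at h2
  have h3 := Real.one_sub_sq_div_two_le_cos (x := θ)
  have h4 : 0.98 ≤ Real.cos θ := by nlinarith [h.arg_lt hn, h.arg_pos]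
  nlinarith

theorem pi_lt (h : IsPolarRoot n r θ) (hn : 32 ≤ n) : Real.pi < (n - 1) * θ := by
  have hn' : (32 : ℝ) ≤ n := by exact_mod_cast hn
  by_contra! hc
  have h1 := Real.sin_nonneg_of_nonneg_of_le_pi (x := (n - 1) * θ)
    (mul_nonneg (by linarith) h.arg_pos.le) hc
  have h2 := Real.sin_pos_of_pos_of_lt_pi h.arg_pos (by linarith [h.arg_lt hn, Real.pi_gt_three])
  have := mul_nonneg (pow_nonneg h.pos.le n) h1
  rw [h.pow_mul_sin] at this
  linarith

/-- As `r < 1` and `sin ((n-1)θ) < 0`, `mul_sin` gives `sin (nθ) > sin ((n-1)θ)`. Hence `cos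
((n-1/2)θ) > 0` at an angle beyond `π`. -/
theorem three_pi_div_two_lt (h : IsPolarRoot n r θ) (hn : 32 ≤ n) :
    3 * Real.pi / 2 < (n - 1 / 2) * θ := by
  have hpi := h.pi_lt hn
  have hθ := h.arg_pos
  have h2 := Real.sin_pos_of_pos_of_lt_pi hθ (by linarith [h.arg_lt hn, Real.pi_gt_three])
  have h3 := Real.sin_pos_of_pos_of_lt_pi (half_pos hθ) (by linarith [h.arg_lt hn, Real.pi_gt_three])
  have hneg : Real.sin ((n - 1) * θ) < 0 := by
    have h4 := h.pow_mul_sin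
    have h5 := pow_pos h.pos n
    by_contra! hc
    nlinarith [mul_nonneg h5.le hc]
  have hdiff : Real.sin (n * θ) - Real.sin ((n - 1) * θ) =
      2 * Real.sin (θ / 2) * Real.cos ((n - 1 / 2) * θ) := by
    rw [Real.sin_sub_sin]; ring_nf
  have hpos : 0 < Real.sin (n * θ) - Real.sin ((n - 1) * θ) := by
    rw [← h.mul_sin]; nlinarith [h.lt_one hn]
  rw [hdiff] at hpos
  by_contra! hc
  have := Real.cos_nonpos_of_pi_div_two_le_of_le (x := (n - 1 / 2) * θ) (by nlinarith) (by linarith)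
  nlinarith

/-- `r ^ n` is the distance from the root to `1`, and `sin θ` is the distance from `1` to the line
through `0` and the root. -/
theorem sin_le_pow (h : IsPolarRoot n r θ) : Real.sin θ ≤ r ^ n := by
  have h1 := h.pow_sq
  have h2 := Real.sin_sq_add_cos_sq θ
  exact le_of_sq_le_sq (by nlinarith [sq_nonneg (r - Real.cos θ)]) (pow_nonneg h.pos.le n)

theorem ge_94 (h : IsPolarRoot n r θ) (hn : 32 ≤ n) : 0.94 ≤ r := by
  have hn' : (32 : ℝ) ≤ n := by exact_mod_cast hn
  -- If `r < 0.94`, then `n sin θ ≤ n * 0.94 ^ n ≤ 4.5`, whereas `nθ > 3π/2` and `sin θ ≥ 0.99 θ`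
  -- force more than `4.6`.
  have hdec : ∀ m : ℕ, 32 ≤ m → (m : ℝ) * 0.94 ^ m ≤ 4.5 := by
    intro m hm
    induction m, hm using Nat.le_induction with
    | base => norm_num
    | succ m hm ih =>
      have hm' : (32 : ℝ) ≤ m := by exact_mod_cast hm
      have : (0 : ℝ) < 0.94 ^ m := by positivity
      rw [pow_succ]; push_cast
      nlinarith
  by_contra! hc
  have h1 : r ^ n ≤ 0.94 ^ n := pow_le_pow_left₀ h.pos.le hc.le n
  have h2 := h.sin_le_pow.trans h1
  have h3 := Real.sin_gt_sub_cube h.arg_pos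
  have h4 := h.three_pi_div_two_lt hn
  have h5 := hdec n hn
  have h6 := h.arg_lt hn
  have h7 := h.arg_pos
  have hpi := Real.pi_gt_d2
  have h8 : θ * 0.99 ≤ θ - θ ^ 3 / 6 := by nlinarith [mul_pos h7 h7]
  nlinarith

/-- With `x = (n-1)θ - 3π/2`, `mul_sin` becomes `r = cos θ - sin θ tan x`. If `θ > θ₀`, then `tan x
≥ x₀`, so `r ≤ q` and `r ^ n ≤ q ^ N < sin θ₀ ≤ sin θ`, against `sin_le_pow`. -/
theorem arg_le_of_pow_lt_sin (h : IsPolarRoot n r θ) {N : ℕ} {x₀ θ₀ q : ℝ} (hN : 32 ≤ N)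
    (hn : N ≤ n) (hθ₀ : 0 ≤ θ₀) (hx₀ : 0 < x₀) (hx : x₀ + 3 * Real.pi / 2 ≤ (N - 1) * θ₀)
    (hq : Real.cos θ₀ - x₀ * Real.sin θ₀ ≤ q) (hqN : q ^ N < Real.sin θ₀) : θ ≤ θ₀ := by
  have hN' : (32 : ℝ) ≤ N := by exact_mod_cast hN
  have hn' : (N : ℝ) ≤ n := by exact_mod_cast hn
  by_contra! hc
  have h32 : 32 ≤ n := hN.trans hn
  have hpi := Real.pi_gt_three
  have hθ := h.arg_lt h32
  set x := (n - 1) * θ - 3 * Real.pi / 2 with hxdef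
  have hx0 : x₀ ≤ x := by nlinarith
  have hx1 : x < Real.pi / 2 := by nlinarith [h.arg_le]
  have hcos : 0 < Real.cos x := Real.cos_pos_of_mem_Ioo ⟨by linarith, hx1⟩
  have htan : x₀ * Real.cos x ≤ Real.sin x := by
    have := Real.lt_tan (by linarith : 0 < x) hx1
    rw [Real.tan_eq_sin_div_cos, lt_div_iff₀ hcos] at this
    nlinarith
  have e1 : Real.sin ((n - 1) * θ) = -Real.cos x := by
    rw [show (n - 1) * θ = (x + Real.pi / 2) + Real.pi by rw [hxdef]; ring,
      Real.sin_add_pi, Real.sin_add_pi_div_two]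
  have e2 : Real.cos ((n - 1) * θ) = Real.sin x := by
    rw [show (n - 1) * θ = (x + Real.pi / 2) + Real.pi by rw [hxdef]; ring,
      Real.cos_add_pi, Real.cos_add_pi_div_two, neg_neg]
  have hms := h.mul_sin
  rw [show (n : ℝ) * θ = (n - 1) * θ + θ by ring, Real.sin_add, e1, e2] at hms
  have hsin : Real.sin θ₀ ≤ Real.sin θ :=
    Real.sin_le_sin_of_le_of_le_pi_div_two (by linarith) (by linarith) hc.le
  have hcosθ : Real.cos θ ≤ Real.cos θ₀ :=
    Real.cos_le_cos_of_nonneg_of_le_pi hθ₀ (by linarith) hc.le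
  have hsin0 : 0 ≤ Real.sin θ₀ := Real.sin_nonneg_of_nonneg_of_le_pi hθ₀ (by linarith)
  have hrq : r ≤ q := by
    have h1 : r * Real.cos x ≤ (Real.cos θ - x₀ * Real.sin θ) * Real.cos x := by
      have := mul_le_mul_of_nonneg_right htan (hsin0.trans hsin)
      nlinarith
    have h2 := le_of_mul_le_mul_right h1 hcos
    nlinarith
  have h3 : r ^ n ≤ r ^ N := pow_le_pow_of_le_one h.pos.le (h.lt_one h32).le hn
  have h4 : r ^ N ≤ q ^ N := pow_le_pow_left₀ h.pos.le hrq N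
  linarith [h.sin_le_pow]

/-- For `r ≤ r₁` the power itself is small. For `r ≥ r₁`, `|1 - z₁| ^ 2` is below a convex quadratic
in `r`, checked at `r₁` and at `1`, where it equals `θ₀ ^ 2`. -/
theorem pow_le_of_arg_le (h : IsPolarRoot n r θ) {N : ℕ} {θ₀ r₁ D : ℝ} (hN : 32 ≤ N) (hn : N ≤ n)
    (hθ : θ ≤ θ₀) (hD : 0 ≤ D) (hr1 : r₁ ≤ 1) (hr1D : r₁ ^ N ≤ D)
    (h1 : 1 + r₁ ^ 2 - 2 * r₁ * (1 - θ₀ ^ 2 / 2) ≤ D ^ 2) (h2 : θ₀ ^ 2 ≤ D ^ 2) : r ^ n ≤ D := by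
  have h32 : 32 ≤ n := hN.trans hn
  have hlt := h.lt_one h32
  rcases le_total r r₁ with hc | hc
  · exact (pow_le_pow_of_le_one h.pos.le hlt.le hn).trans
      ((pow_le_pow_left₀ h.pos.le hc N).trans hr1D)
  · refine le_of_sq_le_sq ?_ hD
    rw [h.pow_sq]
    have hcos := Real.one_sub_sq_div_two_le_cos (x := θ)
    have hsq : θ ^ 2 ≤ θ₀ ^ 2 := pow_le_pow_left₀ h.arg_pos.le hθ 2
    have h3 : 1 + r ^ 2 - 2 * r * Real.cos θ ≤ 1 + r ^ 2 - 2 * r * (1 - θ₀ ^ 2 / 2) := by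
      nlinarith [h.pos]
    refine h3.trans ?_
    rcases eq_or_lt_of_le hr1 with hr | hr
    · nlinarith
    · have h4 : 0 ≤ (r - r₁) * (1 - r) := mul_nonneg (by linarith) (by linarith)
      have h5 := mul_le_mul_of_nonneg_left h1 (by linarith : 0 ≤ 1 - r)
      have h6 := mul_le_mul_of_nonneg_left h2 (by linarith : 0 ≤ r - r₁)
      have h7 : (1 - r₁) * (1 + r ^ 2 - 2 * r * (1 - θ₀ ^ 2 / 2)) ≤ (1 - r₁) * D ^ 2 := by
        nlinarith [mul_nonneg h4 (by linarith : 0 ≤ 1 - r₁)]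
      exact le_of_mul_le_mul_left h7 (by linarith)

theorem arg_le_161 (h : IsPolarRoot n r θ) (hn : 32 ≤ n) : θ ≤ 0.161 := by
  have hs := Real.sin_gt_sub_cube (x := 0.161) (by norm_num)
  have hc := (abs_le.1 (Real.cos_bound (x := 0.161) (by norm_num [abs_of_pos]))).2
  rw [abs_of_pos (by norm_num)] at hc
  have hpi := Real.pi_lt_d4
  refine h.arg_le_of_pow_lt_sin (N := 32) (x₀ := 0.2785) (q := 0.943) le_rfl hn (by norm_num)
    (by norm_num) ?_ ?_ ?_
  · norm_num at hpi ⊢; linarith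
  · norm_num at hs hc ⊢; linarith
  · norm_num at hs ⊢; linarith

theorem arg_le_1525 (h : IsPolarRoot n r θ) (hn : 34 ≤ n) : θ ≤ 0.1525 := by
  have hs := Real.sin_gt_sub_cube (x := 0.1525) (by norm_num)
  have hc := (abs_le.1 (Real.cos_bound (x := 0.1525) (by norm_num [abs_of_pos]))).2
  rw [abs_of_pos (by norm_num)] at hc
  have hpi := Real.pi_lt_d4
  refine h.arg_le_of_pow_lt_sin (N := 34) (x₀ := 0.32) (q := 0.941) (by norm_num) hn (by norm_num)
    (by norm_num) ?_ ?_ ?_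
  · norm_num at hpi ⊢; linarith
  · norm_num at hs hc ⊢; linarith
  · norm_num at hs ⊢; linarith

theorem pow_le_166 (h : IsPolarRoot n r θ) (hn : 32 ≤ n) : r ^ n ≤ 0.166 :=
  -- `r₁` lies just below the 32nd root of `0.166`.
  h.pow_le_of_arg_le (N := 32) (r₁ := 0.9454) le_rfl hn (h.arg_le_161 hn) (by norm_num)
    (by norm_num) (by norm_num) (by norm_num) (by norm_num)

theorem pow_le_158 (h : IsPolarRoot n r θ) (hn : 34 ≤ n) : r ^ n ≤ 0.158 :=
  h.pow_le_of_arg_le (N := 34) (r₁ := 0.947) (by norm_num) hn (h.arg_le_1525 hn) (by norm_num)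
    (by norm_num) (by norm_num) (by norm_num) (by norm_num)

/-- This is `Re (z₁ / (1 - z₁)) ≥ 0`. Otherwise Bernoulli gives `r ^ n ≥ 1 - nθ²/2`, which is far
above `0.166` because `nθ ≤ 2π`. -/
theorem le_cos (h : IsPolarRoot n r θ) (hn : 32 ≤ n) : r ≤ Real.cos θ := by
  by_contra! hc
  have hcos := Real.one_sub_sq_div_two_le_cos (x := θ)
  have hθ := h.arg_pos
  have hθ' := h.arg_le_161 hn
  have h1 : (1 - θ ^ 2 / 2) ^ n ≤ r ^ n :=
    pow_le_pow_left₀ (by nlinarith) (hcos.trans hc.le) n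
  have h2 := one_add_mul_le_pow (a := -(θ ^ 2 / 2)) (by nlinarith) n
  rw [← sub_eq_add_neg] at h2
  have h3 : n * θ * θ ≤ 2 * Real.pi * 0.161 := by
    have := h.arg_le
    gcongr
  nlinarith [h.pow_le_166 hn, Real.pi_lt_d2]

theorem le_95 (h : IsPolarRoot n r θ) (hn : 32 ≤ n) (hn' : n ≤ 33) : r ≤ 0.95 := by
  by_contra! hc
  have h1 : r ^ 33 ≤ r ^ n := pow_le_pow_of_le_one h.pos.le (h.lt_one hn).le hn'
  have h2 : (0.95 : ℝ) ^ 33 ≤ r ^ 33 := pow_le_pow_left₀ (by norm_num) hc.le 33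
  have h3 : (0.166 : ℝ) < 0.95 ^ 33 := by norm_num
  linarith [h.pow_le_166 hn]

end IsPolarRoot

/-! ### The inequality on the circle -/

/-- Extracts the factor `r ^ n = |1 - z₁|` that the right side of the main inequality also carries.
-/
theorem mul_pow_two_mul_sub_one_div {n : ℕ} (hn : 1 ≤ n) {r q : ℝ} (hr : 0 < r)
    (hX : r ^ n * q ^ (n - 1) < r) :
    (r * q) ^ (2 * n - 1) / (1 - (r * q) ^ (n - 1)) =
      r ^ n * (r ^ n * q * (q ^ (n - 1)) ^ 2 / (r - r ^ n * q ^ (n - 1))) := by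
  obtain ⟨k, rfl⟩ : ∃ k, n = k + 1 := ⟨n - 1, by omega⟩
  simp only [show 2 * (k + 1) - 1 = 2 * k + 1 by omega, Nat.add_sub_cancel] at hX ⊢
  have h1 : r - r ^ (k + 1) * q ^ k = r * (1 - (r * q) ^ k) := by rw [mul_pow]; ring
  have h2 : 0 < 1 - (r * q) ^ k := by
    rw [← sub_pos, h1] at hX
    exact pos_of_mul_pos_right hX hr.le
  rw [h1]
  field_simp
  ring

/-- The conclusion rearranges to `0.166 Y (2P - 0.9796) < 0.94 (P - 0.9796)`. Inserting `h` leaves a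
convex quadratic inequality in `P`, true on the given interval. -/
theorem rational_endpoint_inequality {P Y : ℝ} (h0 : 1.6994 ≤ P) (h1 : P ≤ 1.7072)
    (h : Y * (2 * P - 0.9796) ≤ 0.98408 * P * (2 * P - 0.9796)) :
    0.166 * Y * P < (P - 1 + 0.0204) * (0.94 - 0.166 * Y) := by
  nlinarith [mul_nonneg (sub_nonneg.2 h0) (sub_nonneg.2 h1)]

set_option maxHeartbeats 1000000 in
/-- The two endpoint inequalities for the convexity argument on the circle. -/
theorem endpoint_inequalities {n : ℕ} (hn : 32 ≤ n) {r θ L : ℝ} (h : IsPolarRoot n r θ)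
    (hL0 : 0.534 < L) (hL1 : L < 0.535) (hE0 : 1.7071 < Real.exp L) (hE1 : Real.exp L < 1.7072) :
    0 < r - r ^ n * (1 + L / n) ^ (n - 1) ∧
    r ^ n * (1 + L / n) * ((1 + L / n) ^ (n - 1)) ^ 2 <
      ((1 + L / n) ^ n - 1 + L / n * (r * (Real.cos θ - r) / (r ^ n) ^ 2)) *
        (r - r ^ n * (1 + L / n) ^ (n - 1)) ∧
    r ^ n * (1 + L / n) * ((1 - L / n) ^ (n - 1)) ^ 2 <
      ((1 + L / n) ^ n - 1 - 0.2877 * 2 + L / n * (r * (Real.cos θ - r) / (r ^ n) ^ 2)) *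
        (r - r ^ n * (1 + L / n) ^ (n - 1)) := by
  have hn' : (32 : ℝ) ≤ n := by exact_mod_cast hn
  set ρ := L / n with hρ
  have hρ0 : 0 < ρ := by rw [hρ]; apply div_pos <;> linarith
  have hρ1 : ρ ≤ 0.01672 := by rw [hρ, div_le_iff₀ (by linarith)]; linarith
  set d := r ^ n with hd
  have hd0 : 0 < d := pow_pos h.pos n
  have hdD : d ≤ 0.166 := h.pow_le_166 hn
  have hr := h.ge_94 hn
  set κ := ρ * (r * (Real.cos θ - r) / d ^ 2) with hκ
  have hcr := h.le_cos hn
  have hκ0 : 0 ≤ κ := by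
    have := h.pos
    have : 0 ≤ Real.cos θ - r := by linarith
    positivity
  set P := (1 + ρ) ^ n with hP
  set Y := (1 + ρ) ^ (n - 1) with hY
  set Z := (1 - ρ) ^ (n - 1) with hZ
  have hPY : (1 + ρ) * Y = P := by rw [hP, hY, ← pow_succ', Nat.sub_add_cancel (by omega)]
  have hY0 : 0 < Y := by positivity
  have hP0 : 1.6994 ≤ P := by
    refine le_trans ?_ (exp_mul_le_one_add_div_pow (by omega : 0 < n) (by linarith) (by linarith))
    have h1 : L ^ 2 / (2 * n) ≤ 0.004473 := by
      rw [div_le_iff₀ (by linarith)]; nlinarith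
    nlinarith
  have hP1 : P ≤ 1.7072 :=
    (one_add_div_pow_le_exp (by omega : 0 < n) (by linarith)).trans hE1.le
  have hYP : Y ≤ P := by nlinarith
  have hZ0 : 0 ≤ Z := pow_nonneg (by linarith) _
  have hZ1 : Z ≤ 0.596 := by
    have h1 : (1 - ρ) * Z = (1 + -L / n) ^ n := by
      rw [hZ, ← pow_succ', Nat.sub_add_cancel (by omega), hρ, neg_div, sub_eq_add_neg]
    have h2 := one_add_div_pow_le_exp (by omega : 0 < n) (x := -L) (by linarith)
    rw [← h1, Real.exp_neg] at h2
    have h3 : (Real.exp L)⁻¹ ≤ 0.5858 := by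
      rw [inv_le_comm₀ (by linarith) (by norm_num)]; norm_num at hE0 ⊢; linarith
    nlinarith
  have hdY : d * Y ≤ 0.166 * Y := by gcongr
  refine ⟨by nlinarith, ?_, ?_⟩
  · rw [show d * (1 + ρ) * Y ^ 2 = d * Y * P by rw [← hPY]; ring]
    -- With only `d ≤ 0.166` and `κ ≥ 0` the numbers do not close: small `n` needs `κ ≥ 0.0204`,
    -- larger `n` the sharper bound on `d`.
    rcases Nat.lt_or_ge n 34 with hlt | hge
    · have hn3 : (n : ℝ) ≤ 33 := by exact_mod_cast (by omega : n ≤ 33)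
      have hρ2 : 0.01618 ≤ ρ := by rw [hρ, le_div_iff₀ (by linarith)]; linarith
      have hr95 := h.le_95 hn (by omega)
      have hcos := Real.one_sub_sq_div_two_le_cos (x := θ)
      have hθ := h.arg_le_161 hn
      have hc1 : 0.037 ≤ Real.cos θ - r := by nlinarith [h.arg_pos]
      have hκ1 : 0.0204 ≤ κ := by
        have hd2 : d ^ 2 ≤ 0.166 ^ 2 := by gcongr
        have h1 : 0.94 * 0.037 ≤ r * (Real.cos θ - r) := by gcongr
        have h2 : 1.262 ≤ r * (Real.cos θ - r) / d ^ 2 := by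
          rw [le_div_iff₀ (by positivity)]; nlinarith
        calc (0.0204 : ℝ) ≤ 0.01618 * 1.262 := by norm_num
          _ ≤ κ := by rw [hκ]; gcongr
      -- `0.98408` bounds `1 / (1 + ρ)`, since `ρ ≥ 0.01618`.
      have hYP' : Y ≤ 0.98408 * P := by nlinarith
      have h1 : d * Y * P ≤ 0.166 * Y * P := by gcongr
      have h2 : (P - 1 + 0.0204) * (0.94 - 0.166 * Y) ≤ (P - 1 + κ) * (r - d * Y) := by
        apply mul_le_mul <;> linarith
      have h3 : Y * (2 * P - 0.9796) ≤ 0.98408 * P * (2 * P - 0.9796) := by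
        apply mul_le_mul_of_nonneg_right hYP'; linarith
      linarith [rational_endpoint_inequality hP0 hP1 h3]
    · have hd158 := h.pow_le_158 hge
      have hn4 : (34 : ℝ) ≤ n := by exact_mod_cast hge
      have hP0' : 1.6998 ≤ P := by
        refine le_trans ?_ (exp_mul_le_one_add_div_pow (by omega : 0 < n) (by linarith)
          (by linarith))
        have h1 : L ^ 2 / (2 * n) ≤ 0.00421 := by
          rw [div_le_iff₀ (by linarith)]; nlinarith
        nlinarith
      have hdY' : d * Y ≤ 0.158 * 1.7072 := by gcongr; linarith
      have h1 : d * Y * P ≤ 0.158 * 1.7072 * 1.7072 := by gcongr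
      have h2 : 0.6998 * (0.94 - 0.158 * 1.7072) ≤ (P - 1 + κ) * (r - d * Y) := by
        apply mul_le_mul <;> linarith
      norm_num at h1 h2 ⊢
      linarith
  · have hdY' : d * Y ≤ 0.166 * 1.7072 := by gcongr; linarith
    have h1 : d * (1 + ρ) * Z ^ 2 ≤ 0.166 * (1 + 0.01672) * 0.596 ^ 2 := by gcongr
    have h2 : 0.124 * (0.94 - 0.166 * 1.7072) ≤ (P - 1 - 0.2877 * 2 + κ) * (r - d * Y) := by
      apply mul_le_mul <;> linarith
    norm_num at h1 h2 ⊢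
    linarith

theorem mainTheorem2 (n : ℕ) (hn : 32 ≤ n) :
    ∀ z ∈ Metric.sphere (firstRoot n) (Real.pi * ‖firstRoot n‖ / (n * aMax)),
      ‖z‖ < 1 ∧ ‖z‖ ^ (2 * n - 1) / (1 - ‖z‖ ^ (n - 1)) < ‖-1 + z + z ^ n‖ := by
  intro z hz
  have hn' : (32 : ℝ) ≤ n := by exact_mod_cast hn
  have hroot := isPolarRoot_firstRoot (n := n) (by omega)
  have hG : firstRoot n ^ n = 1 - firstRoot n := by
    have := (firstRoot_spec (n := n) (by omega)).1
    unfold trinomialG at this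
    linear_combination this
  have hre : (firstRoot n).re = ‖firstRoot n‖ * Real.cos (firstRoot n).arg :=
    (Complex.norm_mul_cos_arg _).symm
  set z₁ := firstRoot n
  set r := ‖z₁‖ with hr
  obtain ⟨hE0, hE1⟩ := exp_pi_div_aMax_bounds
  obtain ⟨hL0, hL1⟩ := pi_div_aMax_bounds
  set L := Real.pi / aMax with hL
  obtain ⟨hden, hend1, hend0⟩ := endpoint_inequalities hn hroot hL0 hL1 hE0 hE1
  have hradius : Real.pi * r / (n * aMax) = r * (L / n) := by
    rw [hL, div_div, mul_comm aMax]; ring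
  rw [mem_sphere_iff_norm, hradius] at hz
  set ρ := L / n with hρ
  have hρ0 : 0 < ρ := by rw [hρ]; apply div_pos <;> linarith
  have hρ1 : ρ < 1 := by rw [hρ, div_lt_iff₀ (by linarith)]; linarith
  have hr0 : 0 < r := hroot.pos
  have hz₁ : z₁ ≠ 0 := norm_pos_iff.1 hr0
  have hρC : (ρ : ℂ) ≠ 0 := by exact_mod_cast hρ0.ne'
  obtain ⟨w, hw, rfl⟩ : ∃ w : ℂ, ‖w‖ = 1 ∧ z = z₁ * (1 + ρ * w) := by
    refine ⟨(z - z₁) / (z₁ * ρ), ?_, by field_simp; ring⟩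
    rw [norm_div, hz, norm_mul, Complex.norm_of_nonneg hρ0.le]
    exact div_self (by positivity)
  have hdn : ‖1 - z₁‖ = r ^ n := by rw [← hG, norm_pow]
  set d := r ^ n with hd
  have hd0 : 0 < d := pow_pos hr0 n
  set q := ‖1 + (ρ : ℂ) * w‖ with hq
  have hqle : q ≤ 1 + ρ := by
    refine (norm_add_le _ _).trans ?_
    rw [norm_one, norm_mul, hw, Complex.norm_of_nonneg hρ0.le, mul_one]
  have hq0 : 0 ≤ q := norm_nonneg _
  have hX : q ^ (n - 1) ≤ (1 + ρ) ^ (n - 1) := pow_le_pow_left₀ hq0 hqle _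
  have hdX : r - d * (1 + ρ) ^ (n - 1) ≤ r - d * q ^ (n - 1) := by gcongr
  have hwre := abs_le.1 (hw ▸ Complex.abs_re_le_norm w)
  rw [norm_mul, ← hr, ← hq]
  constructor
  · refine (pow_lt_one_iff_of_nonneg (by positivity) (by omega : n ≠ 0)).1 ?_
    rw [mul_pow]
    have h1 : q ^ n ≤ (1 + ρ) ^ n := pow_le_pow_left₀ hq0 hqle _
    have h2 : (1 + ρ) ^ n ≤ Real.exp L := one_add_div_pow_le_exp (by omega) (by linarith)
    calc r ^ n * q ^ n ≤ 0.166 * 1.7072 := by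
          gcongr
          · exact hroot.pow_le_166 hn
          · linarith
      _ < 1 := by norm_num
  · rw [mul_pow_two_mul_sub_one_div (by omega) hr0 (by linarith)]
    have hδ : (1 - z₁) ≠ 0 := by rw [← norm_pos_iff, hdn]; exact hd0
    have hfac : -1 + z₁ * (1 + ρ * w) + (z₁ * (1 + ρ * w)) ^ n =
        (1 - z₁) * (((1 + ρ * w) ^ n - 1) + ρ * w * (z₁ / (1 - z₁))) := by
      rw [mul_pow, hG]; field_simp; ring
    have hconj : starRingEnd ℂ w * w = 1 := by
      rw [mul_comm, Complex.mul_conj, Complex.normSq_eq_norm_sq, hw]; simp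
    have hquot : (z₁ / (1 - z₁)).re = r * (Real.cos z₁.arg - r) / d ^ 2 := by
      have h1 : Complex.normSq (1 - z₁) = d ^ 2 := by rw [Complex.normSq_eq_norm_sq, hdn]
      have h2 : z₁.re * z₁.re + z₁.im * z₁.im = r ^ 2 := by
        rw [← Complex.normSq_apply, Complex.normSq_eq_norm_sq]
      rw [Complex.div_re, h1, ← add_div]
      congr 1
      simp only [Complex.sub_re, Complex.one_re, Complex.sub_im, Complex.one_im]
      linear_combination hre - h2
    have hlow : (1 + ρ) ^ n - 1 - 0.2877 * (1 - w.re) +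
        ρ * (r * (Real.cos z₁.arg - r) / d ^ 2) ≤
          ‖((1 + ρ * w) ^ n - 1) + ρ * w * (z₁ / (1 - z₁))‖ := by
      have h1 := re_conj_mul_one_add_pow_sub_one_ge (by omega : 0 < n) (by linarith : 0 ≤ L)
        hL1.le hw
      have h2 : starRingEnd ℂ w * (((1 + ρ * w) ^ n - 1) + ρ * w * (z₁ / (1 - z₁))) =
          starRingEnd ℂ w * ((1 + ρ * w) ^ n - 1) + ρ * (z₁ / (1 - z₁)) := by
        linear_combination (ρ * (z₁ / (1 - z₁))) * hconj
      have h3 := Complex.re_le_norm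
        (starRingEnd ℂ w * (((1 + ρ * w) ^ n - 1) + ρ * w * (z₁ / (1 - z₁))))
      rw [norm_mul, Complex.norm_conj, hw, one_mul, h2, Complex.add_re, Complex.re_ofReal_mul,
        hquot] at h3
      linarith
    rw [hfac, norm_mul, hdn]
    refine mul_lt_mul_of_pos_left (lt_of_lt_of_le ?_ hlow) hd0
    have hchord := norm_one_add_mul_sq_pow_le ρ hw (n - 1)
    rw [← hq] at hchord
    set κ := ρ * (r * (Real.cos z₁.arg - r) / d ^ 2)
    set Y := (1 + ρ) ^ (n - 1)
    set Z := (1 - ρ) ^ (n - 1)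
    set X := q ^ (n - 1)
    set P := (1 + ρ) ^ n
    have hl1 : 0 ≤ (1 + w.re) / 2 := by linarith
    have hl0 : 0 ≤ (1 - w.re) / 2 := by linarith
    have hT0 : 0 < P - 1 - 0.2877 * 2 + κ :=
      pos_of_mul_pos_left (lt_of_le_of_lt (by positivity) hend0) hden.le
    rw [div_lt_iff₀ (by linarith)]
    calc d * q * X ^ 2 ≤ d * (1 + ρ) * ((1 + w.re) / 2 * Y ^ 2 + (1 - w.re) / 2 * Z ^ 2) := by
          gcongr
      _ = (1 + w.re) / 2 * (d * (1 + ρ) * Y ^ 2) + (1 - w.re) / 2 * (d * (1 + ρ) * Z ^ 2) := by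
          ring
      _ < (P - 1 - 0.2877 * (1 - w.re) + κ) * (r - d * Y) := by
          -- Convex combination of the strict endpoint inequalities; at `Re w = -1` the first weight
          -- vanishes and only the second one counts.
          rcases hl1.eq_or_lt with hl | hl <;> nlinarith
      _ ≤ (P - 1 - 0.2877 * (1 - w.re) + κ) * (r - d * X) := by
          refine mul_le_mul_of_nonneg_left hdX ?_
          linarith
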